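/- For $n\ge 1$ let $\mathcal{E}_{2n}$ be the set of permutations $\sigma$ of $[2n]=\{1,\dots,2n\}$ such that $i>\sigma(i)$ implies that $i$ is even and $\sigma(i)$ is odd (E-permutations), and let $\mathcal{X}_{2n}$ be the set of permutations $\sigma=\sigma_1\cdots\sigma_{2n}$ of $[2n]$ such that $\sigma_i>\sigma_{i+1}$ implies that $\sigma_i$ is even and $\sigma_{i+1}$ is odd (even-odd descent permutations). For a permutation $\sigma$ let $\mathrm{des}\,\sigma$ be the number of $i$ with $\sigma_i>\sigma_{i+1}$, $\mathrm{lma}\,\sigma$ the number of left-to-right maxima (indices $i$ with $\sigma_j<\sigma_i$ for all $j<i$), $\mathrm{drop}\,\sigma$ the number of $i$ with $\sigma(i)<i$, and $\mathrm{cyc}\,\sigma$ the number of cycles of $\sigma$ (fixed points included). Then for $n\ge 1$ $$P_n(t,z):=\sum_{\sigma\in\mathcal{X}_{2n}}t^{\mathrm{des}\,\sigma}z^{\mathrm{lma}\,\sigma}=\sum_{\sigma\in\mathcal{E}_{2n}}t^{\mathrm{drop}\,\sigma}z^{\mathrm{cyc}\,\sigma},$$ and, as formal power series in $x$ (the infinite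 continued fraction being the coefficientwise limit of its convergents), $$1+\sum_{n\ge 1}P_n(t,z)x^n=\cfrac{1}{1-b_0x-\cfrac{\lambda_1x^2}{1-b_1x-\cfrac{\lambda_2x^2}{1-b_2x-\cdots}}},$$ where for all $n\ge 0$ $$b_n=(z+n)\bigl(z+n+(n+1)t\bigr),\qquad \lambda_{n+1}=(n+1)(z+n)(z+n+1)^2\,t.$$ -/

import Mathlib

namespace EvenOddPerm

/-- The even-odd descent permutations of `[2n]`. The letter `k` of `[2n]` is the element of
`Fin (2 * n)` with value `k - 1`, and `σ` is read as the word `σ 0, σ 1, …, σ (2n - 1)`.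
Every descent (consecutive letters `σ i > σ j`, `j = i + 1`) has an even top and an odd bottom. -/
def evenOddDescentPerms (n : ℕ) : Finset (Equiv.Perm (Fin (2 * n))) :=
  Finset.univ.filter fun σ => ∀ i j : Fin (2 * n), (i : ℕ) + 1 = (j : ℕ) → σ j < σ i →
    Even ((σ i : ℕ) + 1) ∧ Odd ((σ j : ℕ) + 1)

/-- The E-permutations (even-odd drop permutations) of `[2n]`: if `i > σ(i)`, then `i` is even
and `σ(i)` is odd. The letter `k` of `[2n]` is the element of `Fin (2 * n)` with value `k - 1`. -/
def ePerms (n : ℕ) : Finset (Equiv.Perm (Fin (2 * n))) :=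
  Finset.univ.filter fun σ => ∀ i : Fin (2 * n), σ i < i →
    Even ((i : ℕ) + 1) ∧ Odd ((σ i : ℕ) + 1)

/-- The number of descents of the word `σ 0, σ 1, …, σ (m - 1)`. -/
def des {m : ℕ} (σ : Equiv.Perm (Fin m)) : ℕ :=
  (Finset.univ.filter fun p : Fin m × Fin m =>
    (p.1 : ℕ) + 1 = (p.2 : ℕ) ∧ σ p.2 < σ p.1).card

/-- The number of left-to-right maxima of the word `σ 0, σ 1, …, σ (m - 1)`. -/
def lma {m : ℕ} (σ : Equiv.Perm (Fin m)) : ℕ :=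
  (Finset.univ.filter fun i : Fin m => ∀ j : Fin m, j < i → σ j < σ i).card

/-- The number of drops of `σ`, i.e. of `i` with `σ(i) < i`. -/
def drop {m : ℕ} (σ : Equiv.Perm (Fin m)) : ℕ :=
  (Finset.univ.filter fun i : Fin m => σ i < i).card

/-- The number of cycles of `σ`, fixed points included. -/
def cyc {m : ℕ} (σ : Equiv.Perm (Fin m)) : ℕ :=
  Multiset.card σ.partition.parts

/-- `P_n(t, z) = ∑ t ^ des σ * z ^ lma σ` over the even-odd descent permutations of `[2n]`,
for elements `t`, `z` of a commutative ring (in particular for two indeterminates). -/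
def P {R : Type*} [CommRing R] (n : ℕ) (t z : R) : R :=
  ∑ σ ∈ evenOddDescentPerms n, t ^ des σ * z ^ lma σ

open PowerSeries in
/-- The `m`-th convergent, started at row `i`, of the J-fraction with coefficients `b`, `lam`:
`1 / (1 - b i x - lam i x² / (1 - b (i+1) x - lam (i+1) x² / ⋯ ))`, cut after `m` rows.
So `b i` is the usual `b_i` and `lam i` is the usual `λ_{i+1}`. The inverse is that of a power
series with constant coefficient `1`. -/
noncomputable def jConvergent {R : Type*} [CommRing R] (b lam : ℕ → R) : ℕ → ℕ → PowerSeries R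
  | 0, _ => 0
  | m + 1, i => invOfUnit
      (1 - C (b i) * X - C (lam i) * X ^ 2 * jConvergent b lam m (i + 1)) 1

open PowerSeries in
theorem jConvergent_succ_mul {R : Type*} [CommRing R] (b lam : ℕ → R) (m i : ℕ) :
    (1 - C (b i) * X - C (lam i) * X ^ 2 * jConvergent b lam m (i + 1)) *
      jConvergent b lam (m + 1) i = 1 := by
  rw [jConvergent]
  exact mul_invOfUnit _ _ (by simp)

/-- The formal power series `f` equals the infinite J-fraction
`1 / (1 - b 0 x - lam 0 x² / (1 - b 1 x - lam 1 x² / ⋯ ))`: the convergents tend to `f` as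
formal power series, i.e. each coefficient is eventually constant with the value in `f`. -/
def IsJFraction {R : Type*} [CommRing R] (f : PowerSeries R) (b lam : ℕ → R) : Prop :=
  ∀ k : ℕ, ∀ᶠ m in Filter.atTop,
    PowerSeries.coeff k (jConvergent b lam m 0) = PowerSeries.coeff k f

end EvenOddPerm

/-!
Build the permutations of `[2n]` by inserting the letters in decreasing order, each new letter
either freely or right after a larger letter: into a word for descents and left-to-right maxima,
into a cycle for drops and cycles. A word gains a left-to-right maximum, and a permutation gains a
cycle, exactly at the free insertions, and in both pictures a letter `a` is a descent top (drop
position) exactly if something has been inserted after `a`, its bottom being the last such letter.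
So both statistics obey the same recursion.

To follow the parity condition through the insertions, mark by a variable `X` the even letters after
which an odd letter is still to be inserted. Letters are only inserted after marked ones, which
makes such an insertion a derivative in `X`; an even letter leaves the mark in place and an odd one
may remove it, which gives the factors `X` and `1 + X`. At the end no marks may be left. Inserting
an even and then an odd letter maps `p` to `v = (1 + tX)(zp + Xp')` and then to `zv + (1 + X)v'`,
which on coefficients is a product of two bidiagonal matrices. Their product is the tridiagonal
matrix of the J-fraction.
-/

namespace EvenOddPerm

section JFraction

open PowerSeries

variable {R : Type*} [CommRing R]

theorem isJFraction_of_X_pow_dvd_sub {f : PowerSeries R} {b lam : ℕ → R}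
    (h : ∀ m, X ^ m ∣ f - jConvergent b lam m 0) : IsJFraction f b lam := by
  intro k
  filter_upwards [Filter.eventually_gt_atTop k] with m hkm
  have hcoeff := X_pow_dvd_iff.mp (h m) k hkm
  rw [map_sub, sub_eq_zero] at hcoeff
  exact hcoeff.symm

/-- Dividing row `k` of the system by its diagonal after eliminating `A (k + 1)` is one row of the
continued fraction. -/
theorem X_pow_dvd_sub_jConvergent_mul {b u d : ℕ → R} {A s : ℕ → PowerSeries R}
    (hA : ∀ k, A k = s k + X * (C (b k) * A k + C (d k) * A (k + 1)))
    (hs : ∀ k, s (k + 1) = X * C (u k) * A k) (m k : ℕ) :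
    X ^ m ∣ A k - jConvergent b (fun i => u i * d i) m k * s k := by
  induction m generalizing k with
  | zero => exact one_dvd _
  | succ m ih =>
    obtain ⟨g, hg⟩ := ih (k + 1)
    rw [hs] at hg
    have hJ := jConvergent_succ_mul b (fun i => u i * d i) m k
    rw [map_mul] at hJ
    refine ⟨jConvergent b (fun i => u i * d i) (m + 1) k * C (d k) * g, ?_⟩
    linear_combination (-A k) * hJ + jConvergent b (fun i => u i * d i) (m + 1) k * hA k +
      X * C (d k) * jConvergent b (fun i => u i * d i) (m + 1) k * hg

theorem isJFraction_of_tridiagonal {b u d : ℕ → R} {c : ℕ → ℕ → R}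
    (h_zero_zero : c 0 0 = 1) (h_zero_succ : ∀ k, c 0 (k + 1) = 0)
    (h_succ_zero : ∀ n, c (n + 1) 0 = b 0 * c n 0 + d 0 * c n 1)
    (h_succ_succ : ∀ n k, c (n + 1) (k + 1) =
      u k * c n k + b (k + 1) * c n (k + 1) + d (k + 1) * c n (k + 2)) :
    IsJFraction (mk fun n => c n 0) b (fun k => u k * d k) := by
  let A (k : ℕ) : PowerSeries R := mk fun n => c n k
  let s : ℕ → PowerSeries R
    | 0 => 1
    | k + 1 => X * C (u k) * A k
  have hA (k : ℕ) : A k = s k + X * (C (b k) * A k + C (d k) * A (k + 1)) := by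
    ext n
    cases k <;> cases n <;>
      simp [A, s, h_zero_zero, h_zero_succ, h_succ_zero, h_succ_succ, coeff_succ_X_mul, coeff_one,
        mul_assoc, add_assoc]
  refine isJFraction_of_X_pow_dvd_sub fun m => ?_
  simpa only [s, mul_one] using X_pow_dvd_sub_jConvergent_mul hA (fun _ => rfl) m 0

end JFraction

section BottomMap

variable {m : ℕ}

/-- Among the top `m` letters of some `[2n]`, the letter `2n - m + a + 1` represented by `a` is
even. Its parity does not depend on `n`. -/
def IsEvenLetter (a : Fin m) : Prop := Even ((a : ℕ) + m + 1)

instance : DecidablePred (IsEvenLetter (m := m)) :=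
  fun a => inferInstanceAs (Decidable (Even ((a : ℕ) + m + 1)))

theorem isEvenLetter_succ {a : Fin m} : IsEvenLetter a.succ ↔ IsEvenLetter a := by
  simp only [IsEvenLetter, Fin.val_succ]
  grind

theorem isEvenLetter_zero : IsEvenLetter (0 : Fin (m + 1)) ↔ Even m := by
  simp only [IsEvenLetter, Fin.val_zero]
  grind

theorem isEvenLetter_two_mul {n : ℕ} {a : Fin (2 * n)} :
    IsEvenLetter a ↔ Even ((a : ℕ) + 1) := by
  simp only [IsEvenLetter]
  grind

/-- The effect on a bottom map `β` (sending a letter to the bottom of the descent or drop it is the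
top of, if any) of inserting a new smallest letter `0`, after `a` if `q = some a`, and freely if
`q = none`. -/
def insertBottom (q : Option (Fin m)) (β : Fin m → Option (Fin m)) :
    Fin (m + 1) → Option (Fin (m + 1)) :=
  Fin.cons none fun a => if q = some a then some 0 else (β a).map Fin.succ

theorem eq_insertBottom {q : Option (Fin m)} {β : Fin m → Option (Fin m)}
    {γ : Fin (m + 1) → Option (Fin (m + 1))} (h_zero : γ 0 = none)
    (h_succ_zero : ∀ a, γ a.succ = some 0 ↔ q = some a)
    (h_succ_succ : ∀ a b, γ a.succ = some b.succ ↔ q ≠ some a ∧ β a = some b) :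
    γ = insertBottom q β := by
  refine funext (Fin.cases h_zero fun a => Option.ext (Fin.cases ?_ fun b => ?_))
  · rw [h_succ_zero, insertBottom, Fin.cons_succ]
    by_cases h : q = some a <;> simp [h]
  · rw [h_succ_succ, insertBottom, Fin.cons_succ]
    by_cases h : q = some a <;> simp [h, eq_comm]

/-- Every top is an even letter of `[m]` and every bottom an odd one. -/
def IsEvenOdd (β : Fin m → Option (Fin m)) : Prop :=
  ∀ a b, β a = some b → Even ((a : ℕ) + 1) ∧ Odd ((b : ℕ) + 1)

instance : DecidablePred (IsEvenOdd (m := m)) :=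
  fun β => inferInstanceAs (Decidable
    (∀ a b, β a = some b → Even ((a : ℕ) + 1) ∧ Odd ((b : ℕ) + 1)))

/-- The number of letters that have a bottom. -/
def numTops (β : Fin m → Option (Fin m)) : ℕ := Finset.card {a | (β a).isSome}

end BottomMap

section Weight

open Polynomial

variable {R : Type*} [CommSemiring R] {m : ℕ}

/-- The weight of the letter `a` with bottom `o`. The factor `t` counts tops, and `X` marks the even
letters after which an odd letter is still to be inserted. So the mark is required where the
current bottom is even, and optional where it is odd or missing. -/
noncomputable def letterWeight (t : R) (a : Fin m) (o : Option (Fin m)) : R[X] :=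
  if IsEvenLetter a then
    o.elim (1 + C t * X) fun b => C t * if IsEvenLetter b then X else 1 + X
  else o.elim 1 fun _ => 0

theorem letterWeight_succ (t : R) (a : Fin m) (o : Option (Fin m)) :
    letterWeight t a.succ (o.map Fin.succ) = letterWeight t a o := by
  cases o <;> simp only [letterWeight, isEvenLetter_succ, Option.map, Option.elim]

theorem letterWeight_zero_none (t : R) :
    letterWeight t (0 : Fin (m + 1)) none = if Even m then 1 + C t * X else 1 := by
  simp only [letterWeight, isEvenLetter_zero, Option.elim_none]

theorem derivative_letterWeight (t : R) (a : Fin m) (o : Option (Fin m)) :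
    derivative (letterWeight t a o) = if IsEvenLetter a then C t else 0 := by
  unfold letterWeight
  cases o <;> simp only [Option.elim] <;> split_ifs <;> simp

theorem letterWeight_succ_some_zero (t : R) (a : Fin m) (o : Option (Fin m)) :
    letterWeight t a.succ (some 0) =
      (if Even m then X else 1 + X) * derivative (letterWeight t a o) := by
  rw [derivative_letterWeight, mul_ite, mul_zero, mul_comm]
  simp only [letterWeight, isEvenLetter_succ, isEvenLetter_zero, Option.elim_some]

theorem coeff_zero_letterWeight {n : ℕ} (t : R) (a : Fin (2 * n)) (o : Option (Fin (2 * n))) :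
    (letterWeight t a o).coeff 0 =
      if ∀ b, o = some b → Even ((a : ℕ) + 1) ∧ Odd ((b : ℕ) + 1)
        then t ^ (if o.isSome then 1 else 0) else 0 := by
  unfold letterWeight
  simp only [isEvenLetter_two_mul]
  cases o with
  | none => split_ifs <;> simp_all
  | some b =>
    by_cases ha : Even ((a : ℕ) + 1) <;> by_cases hb : Even ((b : ℕ) + 1) <;>
      simp [ha, hb, ← Nat.not_even_iff_odd]

/-- The weight of a permutation with bottom map `β`, up to the factor for its free insertions. -/
noncomputable def weight (t : R) (β : Fin m → Option (Fin m)) : R[X] :=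
  ∏ a, letterWeight t a (β a)

theorem weight_insertBottom_none (t : R) (β : Fin m → Option (Fin m)) :
    weight t (insertBottom none β) = (if Even m then 1 + C t * X else 1) * weight t β := by
  simp only [weight, insertBottom, Fin.prod_univ_succ, Fin.cons_zero, Fin.cons_succ,
    letterWeight_zero_none, reduceCtorEq, if_false, letterWeight_succ]

theorem weight_insertBottom_some (t : R) (a : Fin m) (β : Fin m → Option (Fin m)) :
    weight t (insertBottom (some a) β) =
      (if Even m then 1 + C t * X else 1) * ((if Even m then X else 1 + X) *
        ((∏ x ∈ Finset.univ.erase a, letterWeight t x (β x)) *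
          derivative (letterWeight t a (β a)))) := by
  have hothers : ∀ x ∈ Finset.univ.erase a,
      letterWeight t x.succ (if some a = some x then some 0 else (β x).map Fin.succ) =
        letterWeight t x (β x) := by
    intro x hx
    rw [if_neg fun h => Finset.ne_of_mem_erase hx (Option.some_injective _ h).symm,
      letterWeight_succ]
  simp only [weight, insertBottom, Fin.prod_univ_succ, Fin.cons_zero, Fin.cons_succ,
    letterWeight_zero_none]
  rw [← Finset.mul_prod_erase _ _ (Finset.mem_univ a), if_pos rfl,
    letterWeight_succ_some_zero t a (β a), Finset.prod_congr rfl hothers]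
  ring

theorem sum_weight_insertBottom_some (t : R) (β : Fin m → Option (Fin m)) :
    ∑ a, weight t (insertBottom (some a) β) =
      (if Even m then 1 + C t * X else 1) *
        ((if Even m then X else 1 + X) * derivative (weight t β)) := by
  simp only [weight_insertBottom_some, ← Finset.mul_sum]
  rw [weight, derivative_prod_finset]

theorem coeff_zero_weight {n : ℕ} (t : R) (β : Fin (2 * n) → Option (Fin (2 * n))) :
    (weight t β).coeff 0 = if IsEvenOdd β then t ^ numTops β else 0 := by
  rw [weight, coeff_zero_prod, numTops, Finset.card_filter, ← Finset.prod_pow_eq_pow_sum]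
  rw [Finset.prod_congr rfl fun a _ => coeff_zero_letterWeight t a (β a), Fintype.prod_ite_zero]
  congr!

end Weight

section InsertionScheme

open Equiv Polynomial

/-- A way to build the permutations of `m + 1` letters by inserting a smallest letter `0` into the
permutations of `m` letters, either freely or after a letter `a`. The statistic `count` is the
number of free insertions, and `bottom σ a` is the letter inserted last after `a`. -/
structure InsertionScheme (count : ∀ {m}, Perm (Fin m) → ℕ)
    (bottom : ∀ {m}, Perm (Fin m) → Fin m → Option (Fin m)) where
  insert : ∀ {m}, Option (Fin m) → Perm (Fin m) → Perm (Fin (m + 1))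
  insert_injective : ∀ m, Function.Injective2 (insert (m := m))
  count_zero : ∀ σ : Perm (Fin 0), count σ = 0
  count_insert : ∀ {m} (q : Option (Fin m)) (τ : Perm (Fin m)),
    count (insert q τ) = (if q = none then 1 else 0) + count τ
  bottom_insert : ∀ {m} (q : Option (Fin m)) (τ : Perm (Fin m)),
    bottom (insert q τ) = insertBottom q (bottom τ)

/-- The common weight generating function of all insertion schemes. -/
noncomputable def insertionPoly {R : Type*} [CommSemiring R] (t z : R) : ℕ → R[X]
  | 0 => 1
  | m + 1 => (if Even m then 1 + C t * X else 1) * (C z * insertionPoly t z m +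
      (if Even m then X else 1 + X) * derivative (insertionPoly t z m))

namespace InsertionScheme

variable {count : ∀ {m}, Perm (Fin m) → ℕ}
  {bottom : ∀ {m}, Perm (Fin m) → Fin m → Option (Fin m)}

theorem sum_perm_fin_succ {M : Type*} [AddCommMonoid M] (S : InsertionScheme count bottom) {m : ℕ}
    (f : Perm (Fin (m + 1)) → M) :
    ∑ σ, f σ = ∑ τ : Perm (Fin m), (f (S.insert none τ) + ∑ a, f (S.insert (some a) τ)) := by
  have hbij : Function.Bijective (Function.uncurry (S.insert (m := m))) :=
    (Fintype.bijective_iff_injective_and_card _).mpr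
      ⟨(S.insert_injective m).uncurry, by simp [Fintype.card_perm, Nat.factorial_succ]⟩
  rw [← hbij.sum_comp, Fintype.sum_prod_type_right]
  simp only [Fintype.sum_option, Function.uncurry_apply_pair]

variable {R : Type*} [CommSemiring R]

theorem sum_weight_eq_insertionPoly (S : InsertionScheme count bottom) (t z : R) (m : ℕ) :
    ∑ σ : Perm (Fin m), C z ^ count σ * weight t (bottom σ) = insertionPoly t z m := by
  induction m with
  | zero => simp [weight, insertionPoly, S.count_zero]
  | succ m ih =>
    have hderiv (τ : Perm (Fin m)) : derivative (C z ^ count τ * weight t (bottom τ)) =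
        C z ^ count τ * derivative (weight t (bottom τ)) := by
      rw [← C_pow, derivative_C_mul]
    rw [S.sum_perm_fin_succ, insertionPoly, ← ih, derivative_sum, Finset.mul_sum, Finset.mul_sum,
      ← Finset.sum_add_distrib, Finset.mul_sum]
    refine Finset.sum_congr rfl fun τ _ => ?_
    simp only [S.count_insert, S.bottom_insert, reduceCtorEq, if_true, if_false, zero_add,
      ← Finset.mul_sum, weight_insertBottom_none, sum_weight_insertBottom_some, hderiv]
    ring

theorem sum_isEvenOdd_eq_coeff_zero (S : InsertionScheme count bottom) (t z : R) (n : ℕ) :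
    ∑ σ : Perm (Fin (2 * n)) with IsEvenOdd (bottom σ), t ^ numTops (bottom σ) * z ^ count σ =
      (insertionPoly t z (2 * n)).coeff 0 := by
  simp only [← S.sum_weight_eq_insertionPoly, finsetSum_coeff, ← C_pow, coeff_C_mul,
    coeff_zero_weight, Finset.sum_filter, ite_mul, zero_mul, mul_comm (z ^ _)]

end InsertionScheme

end InsertionScheme

section Tridiagonal

open Polynomial

section Coefficients

variable {R : Type*} [CommSemiring R] (t z : R) (n k : ℕ)

theorem coeff_C_mul_add_X_mul_derivative (p : R[X]) :
    (C z * p + X * derivative p).coeff k = (z + k) * p.coeff k := by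
  cases k with
  | zero => simp
  | succ k =>
    rw [coeff_add, coeff_C_mul, coeff_X_mul, coeff_derivative]
    push_cast
    ring

theorem coeff_zero_insertionPoly_odd :
    (insertionPoly t z (2 * n + 1)).coeff 0 = z * (insertionPoly t z (2 * n)).coeff 0 := by
  simp [insertionPoly, add_mul]

theorem coeff_succ_insertionPoly_odd :
    (insertionPoly t z (2 * n + 1)).coeff (k + 1) =
      (z + (k + 1)) * (insertionPoly t z (2 * n)).coeff (k + 1) +
        t * (z + k) * (insertionPoly t z (2 * n)).coeff k := by
  rw [insertionPoly, if_pos (even_two_mul n), if_pos (even_two_mul n), add_mul, one_mul, mul_assoc,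
    coeff_add, coeff_C_mul, coeff_X_mul, coeff_C_mul_add_X_mul_derivative,
    coeff_C_mul_add_X_mul_derivative]
  push_cast
  ring

theorem coeff_insertionPoly_even_succ :
    (insertionPoly t z (2 * (n + 1))).coeff k =
      (z + k) * (insertionPoly t z (2 * n + 1)).coeff k +
        (k + 1) * (insertionPoly t z (2 * n + 1)).coeff (k + 1) := by
  have hodd : ¬Even (2 * n + 1) := Nat.not_even_bit1 n
  rw [mul_add_one, insertionPoly, if_neg hodd, if_neg hodd, one_mul, add_mul, one_mul,
    add_comm (derivative _), ← add_assoc, coeff_add, coeff_C_mul_add_X_mul_derivative,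
    coeff_derivative, mul_comm (coeff _ _)]

theorem coeff_zero_insertionPoly_even_succ :
    (insertionPoly t z (2 * (n + 1))).coeff 0 =
      z * (z + t) * (insertionPoly t z (2 * n)).coeff 0 +
        (z + 1) * (insertionPoly t z (2 * n)).coeff 1 := by
  rw [coeff_insertionPoly_even_succ, coeff_zero_insertionPoly_odd, coeff_succ_insertionPoly_odd]
  push_cast
  ring

theorem coeff_succ_insertionPoly_even_succ :
    (insertionPoly t z (2 * (n + 1))).coeff (k + 1) =
      t * (z + k) * (z + k + 1) * (insertionPoly t z (2 * n)).coeff k +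
        (z + (k + 1)) * (z + (k + 1) + (k + 2) * t) *
          (insertionPoly t z (2 * n)).coeff (k + 1) +
        (k + 2) * (z + k + 2) * (insertionPoly t z (2 * n)).coeff (k + 2) := by
  rw [coeff_insertionPoly_even_succ, coeff_succ_insertionPoly_odd, coeff_succ_insertionPoly_odd]
  push_cast
  ring

end Coefficients

theorem isJFraction_insertionPoly {R : Type*} [CommRing R] (t z : R) :
    IsJFraction (PowerSeries.mk fun n => (insertionPoly t z (2 * n)).coeff 0)
      (fun n : ℕ => (z + n) * (z + n + (n + 1) * t))
      (fun n : ℕ => (n + 1) * (z + n) * (z + n + 1) ^ 2 * t) := by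
  have hlam : (fun n : ℕ => (n + 1) * (z + n) * (z + n + 1) ^ 2 * t) =
      fun n : ℕ => t * (z + n) * (z + n + 1) * ((n + 1) * (z + n + 1)) := by
    funext n
    ring
  rw [hlam]
  refine isJFraction_of_tridiagonal (c := fun n k => (insertionPoly t z (2 * n)).coeff k)
    coeff_one_zero (fun k => ?_) (fun n => ?_) (fun n k => ?_)
  · exact (coeff_one).trans (if_neg k.succ_ne_zero)
  · rw [coeff_zero_insertionPoly_even_succ]
    push_cast
    ring
  · rw [coeff_succ_insertionPoly_even_succ]
    push_cast
    ring

end Tridiagonal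

section CycleMaxima

open Equiv

variable {α : Type*} [Fintype α] [LinearOrder α]

/-- The maxima of the cycles of `σ`, fixed points included. They represent the cycles without
a quotient. -/
def cycleMaxima (σ : Perm α) : Finset α := {i | ∀ j, σ.SameCycle i j → j ≤ i}

theorem mem_cycleMaxima {σ : Perm α} {i : α} :
    i ∈ cycleMaxima σ ↔ ∀ j, σ.SameCycle i j → j ≤ i := by
  simp only [cycleMaxima, Finset.mem_filter_univ]

theorem card_cycleMaxima_inter_support (σ : Perm α) :
    (cycleMaxima σ ∩ σ.support).card = σ.cycleFactorsFinset.card := by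
  refine Finset.card_bij (fun i _ => σ.cycleOf i) ?_ ?_ ?_
  · exact fun i hi =>
      Perm.cycleOf_mem_cycleFactorsFinset_iff.mpr (Finset.mem_of_mem_inter_right hi)
  · intro i hi j hj hij
    rw [Finset.mem_inter, mem_cycleMaxima] at hi hj
    have hsame : σ.SameCycle i j := (Perm.sameCycle_iff_cycleOf_eq_of_mem_support hi.2 hj.2).mpr hij
    exact le_antisymm (hj.1 i hsame.symm) (hi.1 j hsame)
  · intro c hc
    have hne : c.support.Nonempty := (Perm.mem_cycleFactorsFinset_iff.mp hc).1.nonempty_support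
    have hmem : c.support.max' hne ∈ c.support := c.support.max'_mem hne
    have hcycle : c = σ.cycleOf (c.support.max' hne) := Perm.cycle_is_cycleOf hmem hc
    have hsupp : c.support.max' hne ∈ σ.support := Perm.mem_cycleFactorsFinset_support_le hc hmem
    refine ⟨_, Finset.mem_inter.mpr ⟨mem_cycleMaxima.mpr fun j hj => ?_, hsupp⟩, hcycle.symm⟩
    refine c.support.le_max' j ?_
    rwa [hcycle, Perm.mem_support_cycleOf_iff' (Perm.mem_support.mp hsupp)]

theorem cycleMaxima_sdiff_support (σ : Perm α) : cycleMaxima σ \ σ.support = σ.supportᶜ := by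
  ext i
  rw [Finset.mem_sdiff, Finset.mem_compl, mem_cycleMaxima, and_iff_right_iff_imp,
    Perm.notMem_support]
  exact fun hfix j hj => (hj.eq_of_left hfix).ge

theorem card_parts_partition_eq_card_cycleMaxima (σ : Perm α) :
    Multiset.card σ.partition.parts = (cycleMaxima σ).card := by
  rw [Perm.parts_partition, Multiset.card_add, Multiset.card_replicate, Perm.cycleType_def,
    Multiset.card_map, Finset.card_val, ← Finset.card_compl, ← card_cycleMaxima_inter_support,
    ← cycleMaxima_sdiff_support, Finset.card_inter_add_card_sdiff]

end CycleMaxima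

section CycleInsertion

open Equiv

theorem sameCycle_map {α β : Type*} {σ : Perm α} {τ : Perm β} {f : α → β}
    (h : ∀ x, τ.SameCycle (f x) (f (σ x))) {x y : α} (hxy : σ.SameCycle x y) :
    τ.SameCycle (f x) (f y) := by
  obtain ⟨k, rfl⟩ := hxy
  induction k with
  | zero => exact Perm.SameCycle.rfl
  | succ k ih =>
    rw [add_comm, zpow_one_add]
    exact ih.trans (h _)
  | pred k ih =>
    have hstep := h ((σ ^ (-(k : ℤ) - 1)) x)
    rw [← Perm.mul_apply, ← zpow_one_add, add_sub_cancel] at hstep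
    exact ih.trans hstep.symm

variable {m : ℕ}

/-- The permutation `τ` with a new letter `0`, which is a fixed point or is inserted after the
letter `a` into its cycle. -/
def cycleInsert (q : Option (Fin m)) (τ : Perm (Fin m)) : Perm (Fin (m + 1)) :=
  Perm.decomposeFin.symm ((finSuccEquiv m).symm (q.map τ), τ)

theorem cycleInsert_none_zero (τ : Perm (Fin m)) : cycleInsert none τ 0 = 0 := by
  simp [cycleInsert]

theorem cycleInsert_some_zero (a : Fin m) (τ : Perm (Fin m)) :
    cycleInsert (some a) τ 0 = (τ a).succ := by
  simp [cycleInsert]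

theorem cycleInsert_succ (q : Option (Fin m)) (τ : Perm (Fin m)) (x : Fin m) :
    cycleInsert q τ x.succ = if q = some x then 0 else (τ x).succ := by
  cases q with
  | none => simp [cycleInsert]
  | some a => simp [cycleInsert, swap_apply_def, eq_comm (a := a)]

theorem cycleInsert_injective (m : ℕ) : Function.Injective2 (cycleInsert (m := m)) := by
  intro q q' τ τ' h
  obtain ⟨hq, rfl⟩ := Prod.mk.inj (Perm.decomposeFin.symm.injective h)
  exact ⟨Option.map_injective τ.injective ((finSuccEquiv m).symm.injective hq), rfl⟩

theorem sameCycle_cycleInsert_succ_apply (q : Option (Fin m)) (τ : Perm (Fin m)) (x : Fin m) :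
    (cycleInsert q τ).SameCycle x.succ (τ x).succ := by
  by_cases h : q = some x
  · subst h
    rw [← cycleInsert_some_zero, Perm.sameCycle_apply_right]
    have hzero : cycleInsert (some x) τ x.succ = 0 := by rw [cycleInsert_succ, if_pos rfl]
    exact hzero ▸ Perm.sameCycle_apply_right.mpr Perm.SameCycle.rfl
  · have hsucc : cycleInsert q τ x.succ = (τ x).succ := by rw [cycleInsert_succ, if_neg h]
    exact hsucc ▸ Perm.sameCycle_apply_right.mpr Perm.SameCycle.rfl

/-- The converse direction contracts the new letter to the letter it was inserted after. -/
theorem sameCycle_cycleInsert_succ_iff {q : Option (Fin m)} {τ : Perm (Fin m)} {x y : Fin m} :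
    (cycleInsert q τ).SameCycle x.succ y.succ ↔ τ.SameCycle x y := by
  refine ⟨fun h => ?_, sameCycle_map (sameCycle_cycleInsert_succ_apply q τ)⟩
  refine sameCycle_map (f := Fin.cases (q.getD x) id) (Fin.cases ?_ fun i => ?_) h
  · cases q <;> simp [cycleInsert_none_zero, cycleInsert_some_zero, Perm.SameCycle.refl]
  · rw [cycleInsert_succ]
    split_ifs with hi <;> simp [hi, Perm.SameCycle.refl]

theorem zero_mem_cycleMaxima_cycleInsert_iff {q : Option (Fin m)} {τ : Perm (Fin m)} :
    0 ∈ cycleMaxima (cycleInsert q τ) ↔ q = none := by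
  rw [mem_cycleMaxima]
  cases q with
  | none => simpa using fun j hj => (Perm.SameCycle.eq_of_left hj (cycleInsert_none_zero τ)).symm
  | some a =>
    simp only [reduceCtorEq, iff_false, not_forall]
    refine ⟨(τ a).succ, ?_, (Fin.succ_pos _).not_ge⟩
    rw [← cycleInsert_some_zero, Perm.sameCycle_apply_right]

theorem succ_mem_cycleMaxima_cycleInsert_iff {q : Option (Fin m)} {τ : Perm (Fin m)} {i : Fin m} :
    i.succ ∈ cycleMaxima (cycleInsert q τ) ↔ i ∈ cycleMaxima τ := by
  simp only [mem_cycleMaxima, Fin.forall_fin_succ, sameCycle_cycleInsert_succ_iff,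
    Fin.succ_le_succ_iff, Fin.zero_le, implies_true, true_and]

theorem cyc_cycleInsert (q : Option (Fin m)) (τ : Perm (Fin m)) :
    cyc (cycleInsert q τ) = (if q = none then 1 else 0) + cyc τ := by
  simp only [cyc, card_parts_partition_eq_card_cycleMaxima]
  rw [← Finset.filter_univ_mem (cycleMaxima (cycleInsert q τ)),
    ← Finset.filter_univ_mem (cycleMaxima τ), Fin.card_filter_univ_succ']
  simp only [zero_mem_cycleMaxima_cycleInsert_iff, succ_mem_cycleMaxima_cycleInsert_iff]

/-- The bottom map of the drops of `σ`: a drop at `a` has the bottom `σ a`. -/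
def dropBottom (σ : Perm (Fin m)) (a : Fin m) : Option (Fin m) :=
  if σ a < a then some (σ a) else none

theorem dropBottom_eq_some {σ : Perm (Fin m)} {a b : Fin m} :
    dropBottom σ a = some b ↔ σ a = b ∧ b < a := by
  rw [dropBottom, Option.ite_none_right_eq_some, Option.some_inj, and_comm]
  exact and_congr_right fun h => h ▸ Iff.rfl

theorem dropBottom_cycleInsert (q : Option (Fin m)) (τ : Perm (Fin m)) :
    dropBottom (cycleInsert q τ) = insertBottom q (dropBottom τ) := by
  refine eq_insertBottom (if_neg (Fin.not_lt_zero _)) (fun a => ?_) (fun a b => ?_)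
  · rw [dropBottom_eq_some, cycleInsert_succ]
    simp
  · rw [dropBottom_eq_some, dropBottom_eq_some, cycleInsert_succ]
    by_cases h : q = some a <;> simp [h, (Fin.succ_ne_zero b).symm]

/-- Insertion of a smallest letter into the cycles of a permutation. -/
def cycleScheme : InsertionScheme cyc dropBottom where
  insert := cycleInsert
  insert_injective := cycleInsert_injective
  count_zero σ := by
    rw [cyc, card_parts_partition_eq_card_cycleMaxima, Finset.eq_empty_of_isEmpty (cycleMaxima σ),
      Finset.card_empty]
  count_insert := cyc_cycleInsert
  bottom_insert := dropBottom_cycleInsert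

theorem filter_isEvenOdd_dropBottom (n : ℕ) :
    ({σ | IsEvenOdd (dropBottom σ)} : Finset (Perm (Fin (2 * n)))) = ePerms n := by
  refine Finset.filter_congr fun σ _ => ?_
  simp only [IsEvenOdd, dropBottom_eq_some, and_imp, forall_eq']

theorem numTops_dropBottom (σ : Perm (Fin m)) : numTops (dropBottom σ) = drop σ := by
  rw [numTops, drop]
  refine congrArg Finset.card (Finset.filter_congr fun a _ => ?_)
  simp only [dropBottom, Option.isSome_ite]

theorem sum_ePerms_eq_coeff_zero {R : Type*} [CommSemiring R] (n : ℕ) (t z : R) :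
    ∑ σ ∈ ePerms n, t ^ drop σ * z ^ cyc σ = (insertionPoly t z (2 * n)).coeff 0 := by
  simp only [← cycleScheme.sum_isEvenOdd_eq_coeff_zero, filter_isEvenOdd_dropBottom,
    numTops_dropBottom]

end CycleInsertion

section WordInsertion

open Equiv

variable {m : ℕ}

theorem val_succAbove_add_one_eq_iff {p : Fin (m + 1)} {i : Fin m} :
    (p.succAbove i : ℕ) + 1 = p ↔ p = i.succ := by
  simp only [Fin.succAbove, Fin.lt_def, Fin.ext_iff, Fin.val_castSucc, Fin.val_succ]
  split_ifs <;> simp only [Fin.val_castSucc, Fin.val_succ] <;> omega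

theorem val_succAbove_add_one_eq_val_succAbove_iff {p : Fin (m + 1)} {i j : Fin m} :
    (p.succAbove i : ℕ) + 1 = p.succAbove j ↔ p ≠ i.succ ∧ (i : ℕ) + 1 = j := by
  simp only [Fin.succAbove, Fin.lt_def, Fin.ext_iff, Ne, Fin.val_castSucc, Fin.val_succ]
  split_ifs <;> simp only [Fin.val_castSucc, Fin.val_succ] <;> omega

/-- The position at which the letter `0` enters the word `τ`: at the start, or right after the
letter `a`. -/
def insertPos (q : Option (Fin m)) (τ : Perm (Fin m)) : Fin (m + 1) :=
  q.elim 0 fun a => (τ.symm a).succ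

theorem insertPos_left_injective (τ : Perm (Fin m)) :
    Function.Injective fun q => insertPos q τ := by
  rintro (_ | a) (_ | a') h
  · rfl
  · exact absurd h.symm (Fin.succ_ne_zero _)
  · exact absurd h (Fin.succ_ne_zero _)
  · exact congrArg some (τ.symm.injective (Fin.succ_injective _ h))

/-- The word `τ`, its letters increased by one, with the new letter `0` at the start or right after
the letter `a`. -/
def wordInsert (q : Option (Fin m)) (τ : Perm (Fin m)) : Perm (Fin (m + 1)) :=
  ((finSuccEquiv' (insertPos q τ)).trans (optionCongr τ)).trans (finSuccEquiv m).symm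

theorem wordInsert_insertPos (q : Option (Fin m)) (τ : Perm (Fin m)) :
    wordInsert q τ (insertPos q τ) = 0 := by
  simp [wordInsert]

theorem wordInsert_succAbove (q : Option (Fin m)) (τ : Perm (Fin m)) (i : Fin m) :
    wordInsert q τ ((insertPos q τ).succAbove i) = (τ i).succ := by
  simp [wordInsert]

theorem wordInsert_symm_zero (q : Option (Fin m)) (τ : Perm (Fin m)) :
    (wordInsert q τ).symm 0 = insertPos q τ := by
  rw [symm_apply_eq, wordInsert_insertPos]

theorem wordInsert_symm_succ (q : Option (Fin m)) (τ : Perm (Fin m)) (a : Fin m) :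
    (wordInsert q τ).symm a.succ = (insertPos q τ).succAbove (τ.symm a) := by
  rw [symm_apply_eq, wordInsert_succAbove, apply_symm_apply]

theorem wordInsert_injective (m : ℕ) : Function.Injective2 (wordInsert (m := m)) := by
  intro q q' τ τ' h
  have hpos : insertPos q τ = insertPos q' τ' := by
    rw [← wordInsert_symm_zero, h, wordInsert_symm_zero]
  obtain rfl : τ = τ' := by
    ext1 i
    have hi := wordInsert_succAbove q τ i
    rw [h, hpos, wordInsert_succAbove] at hi
    exact (Fin.succ_injective _ hi).symm
  exact ⟨insertPos_left_injective τ hpos, rfl⟩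

theorem lma_wordInsert (q : Option (Fin m)) (τ : Perm (Fin m)) :
    lma (wordInsert q τ) = (if q = none then 1 else 0) + lma τ := by
  have hnew : (∀ j < insertPos q τ, wordInsert q τ j < wordInsert q τ (insertPos q τ)) ↔
      q = none := by
    rw [← (insertPos_left_injective τ).eq_iff]
    simp only [wordInsert_insertPos, Fin.not_lt_zero, imp_false, not_lt]
    exact ⟨fun h => Fin.le_zero_iff.mp (h 0), fun h j => h ▸ Fin.zero_le j⟩
  have hold (i : Fin m) : (∀ j < (insertPos q τ).succAbove i,
      wordInsert q τ j < wordInsert q τ ((insertPos q τ).succAbove i)) ↔ ∀ j < i, τ j < τ i := by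
    rw [Fin.forall_iff_succAbove (insertPos q τ)]
    simp [wordInsert_succAbove, wordInsert_insertPos]
  rw [lma, lma, Finset.card_filter, Finset.card_filter, Fin.sum_univ_succAbove _ (insertPos q τ)]
  simp only [hnew, hold]

/-- The bottom map of the descents of the word `σ`: the bottom of `a` is the next letter, if that
is smaller. -/
def desBottom (σ : Perm (Fin m)) (a : Fin m) : Option (Fin m) :=
  if h : (σ.symm a : ℕ) + 1 < m then
    if σ ⟨σ.symm a + 1, h⟩ < a then some (σ ⟨σ.symm a + 1, h⟩) else none
  else none

theorem desBottom_eq_some {σ : Perm (Fin m)} {a b : Fin m} :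
    desBottom σ a = some b ↔ (σ.symm a : ℕ) + 1 = σ.symm b ∧ b < a := by
  rw [desBottom]
  split_ifs with h h'
  · rw [Option.some_inj, ← σ.eq_symm_apply, Fin.ext_iff]
    refine ⟨fun e => ⟨e, ?_⟩, fun e => e.1⟩
    rwa [σ.eq_symm_apply.mp (Fin.ext e)] at h'
  · simp only [false_iff, not_and]
    intro e
    rwa [σ.eq_symm_apply.mp (Fin.ext e)] at h'
  · simp only [false_iff, not_and]
    omega

theorem desBottom_wordInsert (q : Option (Fin m)) (τ : Perm (Fin m)) :
    desBottom (wordInsert q τ) = insertBottom q (desBottom τ) := by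
  have hq (a : Fin m) : insertPos q τ = (τ.symm a).succ ↔ q = some a :=
    (insertPos_left_injective τ).eq_iff (b := some a)
  refine eq_insertBottom ?_ (fun a => ?_) (fun a b => ?_)
  · exact Option.eq_none_iff_forall_ne_some.mpr fun b hb =>
      Fin.not_lt_zero b (desBottom_eq_some.mp hb).2
  · rw [desBottom_eq_some, wordInsert_symm_zero, wordInsert_symm_succ,
      val_succAbove_add_one_eq_iff, hq, and_iff_left a.succ_pos]
  · rw [desBottom_eq_some, wordInsert_symm_succ, wordInsert_symm_succ,
      val_succAbove_add_one_eq_val_succAbove_iff, Ne, hq, Fin.succ_lt_succ_iff, desBottom_eq_some,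
      and_assoc]

/-- Insertion of a smallest letter into a word. -/
def wordScheme : InsertionScheme lma desBottom where
  insert := wordInsert
  insert_injective := wordInsert_injective
  count_zero σ := by simp [lma]
  count_insert := lma_wordInsert
  bottom_insert := desBottom_wordInsert

theorem filter_isEvenOdd_desBottom (n : ℕ) :
    ({σ | IsEvenOdd (desBottom σ)} : Finset (Perm (Fin (2 * n)))) = evenOddDescentPerms n := by
  refine Finset.filter_congr fun σ _ => ?_
  simp only [IsEvenOdd, desBottom_eq_some, and_imp]
  rw [← σ.forall_congr_right]
  refine forall_congr' fun i => ?_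
  rw [← σ.forall_congr_right]
  simp only [symm_apply_apply]

theorem numTops_desBottom (σ : Perm (Fin m)) : numTops (desBottom σ) = des σ := by
  symm
  refine Finset.card_bij (fun p _ => σ p.1) ?_ ?_ ?_
  · rintro ⟨i, j⟩ hij
    rw [Finset.mem_filter_univ] at hij ⊢
    refine Option.isSome_iff_exists.mpr ⟨σ j, desBottom_eq_some.mpr ?_⟩
    rwa [symm_apply_apply, symm_apply_apply]
  · rintro ⟨i, j⟩ hij ⟨i', j'⟩ hij' h
    rw [Finset.mem_filter_univ] at hij hij'
    obtain rfl : i = i' := σ.injective h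
    exact Prod.ext rfl (Fin.ext (hij.1.symm.trans hij'.1))
  · intro a ha
    rw [Finset.mem_filter_univ, Option.isSome_iff_exists] at ha
    obtain ⟨b, hb⟩ := ha
    rw [desBottom_eq_some] at hb
    refine ⟨(σ.symm a, σ.symm b), (Finset.mem_filter_univ _).mpr ?_, σ.apply_symm_apply a⟩
    rwa [apply_symm_apply, apply_symm_apply]

theorem P_eq_coeff_zero {R : Type*} [CommRing R] (n : ℕ) (t z : R) :
    P n t z = (insertionPoly t z (2 * n)).coeff 0 := by
  simp only [P, ← wordScheme.sum_isEvenOdd_eq_coeff_zero, filter_isEvenOdd_desBottom,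
    numTops_desBottom]

end WordInsertion

end EvenOddPerm

theorem mainTheorem8 {R : Type*} [CommRing R] (t z : R) :
    (∀ n : ℕ, EvenOddPerm.P n t z =
      ∑ σ ∈ EvenOddPerm.ePerms n, t ^ EvenOddPerm.drop σ * z ^ EvenOddPerm.cyc σ) ∧
    EvenOddPerm.IsJFraction
      (PowerSeries.mk fun n : ℕ => if n = 0 then 1 else EvenOddPerm.P n t z)
      (fun n : ℕ => (z + n) * (z + n + (n + 1) * t))
      (fun n : ℕ => (n + 1) * (z + n) * (z + n + 1) ^ 2 * t) := by
  refine ⟨fun n => ?_, ?_⟩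
  · rw [EvenOddPerm.P_eq_coeff_zero, EvenOddPerm.sum_ePerms_eq_coeff_zero]
  · have hcoeff (n : ℕ) : (if n = 0 then 1 else EvenOddPerm.P n t z) =
        (EvenOddPerm.insertionPoly t z (2 * n)).coeff 0 := by
      split_ifs with hn
      · rw [hn, mul_zero, EvenOddPerm.insertionPoly, Polynomial.coeff_one_zero]
      · exact EvenOddPerm.P_eq_coeff_zero n t z
    simpa only [hcoeff] using EvenOddPerm.isJFraction_insertionPoly t z
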